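/- Let $M$ be a von Neumann algebra and let $\tau$ be a faithful normal semifinite trace on $M$. Let $L_1(M_{sa},\tau)$ be the real Banach space obtained by completing $\{x\in M : x=x^*,\ \tau(|x|)<\infty\}$ in the norm $\|x\|_1=\tau(|x|)$, ordered by its positive cone, the norm closure of $\{x\in M : x\ge 0,\ \tau(x)<\infty\}$. A linear operator $T$ on $L_1(M_{sa},\tau)$ is called a positive contraction if $Tx\ge 0$ whenever $x\ge 0$, and $\|Tx\|_1\le\|x\|_1$ for all $x$; for two such operators, $T\le S$ means that $Sx-Tx\ge 0$ for all $x\ge 0$; and $\|\cdot\|$ denotes the operator norm. Let $Z,T,S:L_1(M_{sa},\tau)\to L_1(M_{sa},\tau)$ be positive contractions such that $T\le S$ and $ZS=SZ$. If there is an integer $n_0\ge 1$ such that $\|Z(S^{n_0}-T^{n_0})\|<1$, then $\|Z(S^n-T^n)\|<1$ for every $n\ge n_0$. In particular (the case $Z=\mathrm{Id}$), if $T\le S$ are positive contractions of $L_1(M_{sa},\tau)$ and $\|S^{n_0}-T^{n_0}\|<1$ for some integer $n_0\ge 1$, then $\|S^n-T^n\|<1$ for every $n\ge n_0$. -/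

import Mathlib

open scoped ENNReal

noncomputable section

namespace NCL1

/-! ### Traces and the associated `L₁`-space

The definitions are made for a unital C⋆-algebra `A` with its usual order; they are used below for
a von Neumann algebra. -/

/-- A faithful normal semifinite trace, i.e. a map `τ : A₊ → [0, ∞]` with the usual properties.
It is represented by a function on all of `A`; only its values on the positive cone are
constrained, and only these are ever used. -/
structure FNSTrace (A : Type*) [CStarAlgebra A] [PartialOrder A] [StarOrderedRing A] where
  toFun : A → ℝ≥0∞
  map_add : ∀ x y : A, 0 ≤ x → 0 ≤ y → toFun (x + y) = toFun x + toFun y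
  map_smul : ∀ (c : ℝ) (x : A), 0 ≤ c → 0 ≤ x → toFun (c • x) = ENNReal.ofReal c * toFun x
  tracial : ∀ x : A, toFun (star x * x) = toFun (x * star x)
  faithful : ∀ x : A, 0 ≤ x → toFun x = 0 → x = 0
  /-- `τ` preserves suprema of upward directed sets of positive elements. -/
  normal : ∀ (D : Set A) (x : A), D.Nonempty → DirectedOn (· ≤ ·) D → (∀ d ∈ D, 0 ≤ d) →
    IsLUB D x → IsLUB (toFun '' D) (toFun x)
  /-- Every nonzero positive element dominates a nonzero positive element of finite trace. -/
  semifinite : ∀ x : A, 0 ≤ x → x ≠ 0 → ∃ y : A, 0 ≤ y ∧ y ≤ x ∧ y ≠ 0 ∧ toFun y < ∞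

section Generic

variable {A : Type*} [CStarAlgebra A] [PartialOrder A] [StarOrderedRing A]

instance : CoeFun (FNSTrace A) (fun _ => A → ℝ≥0∞) := ⟨FNSTrace.toFun⟩

namespace FNSTrace

variable (τ : FNSTrace A)

theorem mono {x y : A} (hx : 0 ≤ x) (hxy : x ≤ y) : τ x ≤ τ y := by
  have h := τ.map_add x (y - x) hx (sub_nonneg.2 hxy)
  rw [add_sub_cancel] at h
  rw [h]
  exact le_self_add

theorem map_zero : τ 0 = 0 := by
  simpa using τ.map_smul 0 0 le_rfl le_rfl

theorem conj_le {a F : A} (ha : 0 ≤ a) (hF : IsSelfAdjoint F) (hF1 : F * F ≤ 1) :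
    τ (F * a * F) ≤ τ a := by
  obtain ⟨s, hs, hsa⟩ : ∃ s : A, IsSelfAdjoint s ∧ s * s = a :=
    ⟨CFC.sqrt a, (CFC.sqrt_nonneg a).isSelfAdjoint, CFC.sqrt_mul_sqrt_self a ha⟩
  have h1 : F * a * F = star (s * F) * (s * F) := by
    rw [star_mul, hs.star_eq, hF.star_eq, ← hsa]; simp only [mul_assoc]
  have h2 : (s * F) * star (s * F) = s * (F * F) * star s := by
    rw [star_mul, hF.star_eq]; simp only [mul_assoc]
  have h3 : s * (F * F) * star s ≤ s * 1 * star s := star_right_conjugate_le_conjugate hF1 s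
  have h4 : (0 : A) ≤ (s * F) * star (s * F) := mul_star_self_nonneg _
  rw [h1, τ.tracial, h2]
  refine (τ.mono (h2 ▸ h4) h3).trans ?_
  rw [mul_one, hs.star_eq, hsa]

theorem cutoff_le {x a : A} (hx : IsSelfAdjoint x) (ha : 0 ≤ a) (hxa : x ≤ a) {ε : ℝ}
    (hε : 0 < ε) : τ (cfc (fun t : ℝ => max (t - ε) 0) x) ≤ τ a := by
  set f : ℝ → ℝ := fun t => Real.sqrt (max (t - ε) 0 / max t ε) with hf
  have hpos : ∀ t : ℝ, 0 < max t ε := fun t => lt_max_of_lt_right hε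
  have hfc : Continuous f := by
    refine Real.continuous_sqrt.comp (Continuous.div (by fun_prop) (by fun_prop) ?_)
    exact fun t => (hpos t).ne'
  have hff : ∀ t, f t * f t = max (t - ε) 0 / max t ε := fun t =>
    Real.mul_self_sqrt (div_nonneg (le_max_right _ _) (hpos t).le)
  have hF : IsSelfAdjoint (cfc f x) := cfc_predicate f x
  have hFF : cfc f x * cfc f x ≤ 1 := by
    rw [← cfc_mul f f x (by fun_prop) (by fun_prop)]
    refine cfc_le_one _ x fun t _ => ?_
    rw [hff, div_le_one (hpos t)]
    exact max_le ((by linarith : t - ε ≤ t).trans (le_max_left _ _)) (hpos t).le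
  have hFxF : cfc f x * x * cfc f x = cfc (fun t : ℝ => max (t - ε) 0) x := by
    nth_rewrite 2 [← cfc_id' ℝ x]
    rw [← cfc_mul f _ x (by fun_prop) (by fun_prop),
      ← cfc_mul _ f x (by fun_prop) (by fun_prop)]
    refine cfc_congr fun t _ => ?_
    have h1 : f t * t * f t = (f t * f t) * t := by ring
    simp only [h1, hff]
    rcases le_total t ε with h | h
    · simp [max_eq_right (by linarith : t - ε ≤ 0)]
    · rw [max_eq_left h, max_eq_left (by linarith : 0 ≤ t - ε)]
      exact div_mul_cancel₀ _ (hε.trans_le h).ne'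
  have h5 : cfc f x * x * cfc f x ≤ cfc f x * a * cfc f x := by
    simpa [hF.star_eq] using star_right_conjugate_le_conjugate hxa (cfc f x)
  rw [← hFxF]
  refine (τ.mono ?_ h5).trans (τ.conj_le ha hF hFF)
  rw [hFxF]
  exact cfc_nonneg fun t _ => le_max_right _ _

theorem posPart_le {x a : A} (hx : IsSelfAdjoint x) (ha : 0 ≤ a) (hxa : x ≤ a) :
    τ (x⁺) ≤ τ a := by
  set g : ℝ → ℝ → ℝ := fun ε t => max (t - ε) 0 with hg
  have hpp : x⁺ = cfc (g 0) x := by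
    rw [CFC.posPart_def, cfcₙ_eq_cfc]
    exact cfc_congr fun t _ => by simp [hg, posPart_def]
  have hgc : ∀ ε, Continuous (g ε) := fun ε => by fun_prop
  have hanti : ∀ ε δ : ℝ, ε ≤ δ → cfc (g δ) x ≤ cfc (g ε) x := fun ε δ h =>
    cfc_mono (fun t _ => max_le_max (by linarith) le_rfl)
      (hgc _).continuousOn (hgc _).continuousOn
  set D : Set A := (fun ε : ℝ => cfc (g ε) x) '' Set.Ioi 0 with hD
  have hlub : IsLUB D (x⁺) := by
    constructor
    · rintro _ ⟨ε, hε, rfl⟩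
      rw [hpp]
      exact hanti 0 ε (le_of_lt hε)
    · intro b hb
      have key : ∀ ε : ℝ, 0 < ε → x⁺ ≤ b + algebraMap ℝ A ε := by
        intro ε hε
        have h1 : cfc (g 0) x ≤ cfc (fun t => g ε t + ε) x := by
          refine cfc_mono (fun t _ => ?_) (hgc _).continuousOn
            ((hgc ε).add continuous_const).continuousOn
          simp only [hg]
          rcases max_cases (t - 0) 0 with h | h <;> rcases max_cases (t - ε) 0 with h' | h' <;>
            linarith
        rw [cfc_add_const ε (g ε) x (hgc ε).continuousOn] at h1
        rw [hpp]
        exact h1.trans (add_le_add_left (hb ⟨ε, hε, rfl⟩) _)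
      have hlim : Filter.Tendsto (fun ε : ℝ => b + algebraMap ℝ A ε) (nhdsWithin 0 (Set.Ioi 0))
          (nhds b) := by
        have : Continuous (fun ε : ℝ => b + algebraMap ℝ A ε) :=
          continuous_const.add (continuous_algebraMap ℝ A)
        have h := this.tendsto 0
        simp only [_root_.map_zero, add_zero] at h
        exact h.mono_left nhdsWithin_le_nhds
      exact ge_of_tendsto hlim (Filter.eventually_of_mem self_mem_nhdsWithin key)
  have hdir : DirectedOn (· ≤ ·) D := by
    rintro _ ⟨ε, hε, rfl⟩ _ ⟨δ, hδ, rfl⟩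
    exact ⟨_, ⟨min ε δ, Set.mem_Ioi.2 (lt_min hε hδ), rfl⟩, hanti _ _ (min_le_left _ _),
      hanti _ _ (min_le_right _ _)⟩
  have hn := τ.normal D (x⁺) ⟨_, ⟨1, Set.mem_Ioi.2 one_pos, rfl⟩⟩ hdir
    (by rintro _ ⟨ε, _, rfl⟩; exact cfc_nonneg fun t _ => le_max_right _ _) hlub
  refine hn.2 ?_
  rintro _ ⟨_, ⟨ε, hε, rfl⟩, rfl⟩
  exact τ.cutoff_le hx ha hxa hε

theorem abs_eq {x : A} (hx : IsSelfAdjoint x) : τ (CFC.abs x) = τ (x⁺) + τ (x⁻) := by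
  rw [← CFC.posPart_add_negPart x hx]
  exact τ.map_add _ _ (CFC.posPart_nonneg x) (CFC.negPart_nonneg x)

/-- The triangle inequality for `x ↦ τ(|x|)` on self-adjoint elements. -/
theorem abs_add_le {x y : A} (hx : IsSelfAdjoint x) (hy : IsSelfAdjoint y) :
    τ (CFC.abs (x + y)) ≤ τ (CFC.abs x) + τ (CFC.abs y) := by
  rw [τ.abs_eq hx, τ.abs_eq hy, τ.abs_eq (hx.add hy)]
  have h1 : τ ((x + y)⁺) ≤ τ (x⁺) + τ (y⁺) := by
    rw [← τ.map_add _ _ (CFC.posPart_nonneg x) (CFC.posPart_nonneg y)]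
    exact τ.posPart_le (hx.add hy) (add_nonneg (CFC.posPart_nonneg x) (CFC.posPart_nonneg y))
      (add_le_add (CFC.le_posPart hx) (CFC.le_posPart hy))
  have h2 : τ ((x + y)⁻) ≤ τ (x⁻) + τ (y⁻) := by
    rw [← τ.map_add _ _ (CFC.negPart_nonneg x) (CFC.negPart_nonneg y), ← CFC.posPart_neg]
    refine τ.posPart_le (hx.add hy).neg
      (add_nonneg (CFC.negPart_nonneg x) (CFC.negPart_nonneg y)) ?_
    rw [neg_add]
    exact add_le_add (neg_le.1 (CFC.neg_negPart_le hx)) (neg_le.1 (CFC.neg_negPart_le hy))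
  calc _ ≤ (τ (x⁺) + τ (y⁺)) + (τ (x⁻) + τ (y⁻)) := add_le_add h1 h2
    _ = _ := by ring

theorem abs_smul (c : ℝ) (x : A) : τ (CFC.abs (c • x)) = ENNReal.ofReal ‖c‖ * τ (CFC.abs x) := by
  rw [CFC.abs_smul]
  exact τ.map_smul _ _ (norm_nonneg c) (CFC.abs_nonneg x)

/-- The real vector space `𝔑_sa = {x = x⋆ : τ(|x|) < ∞}`. -/
def finiteSA : Submodule ℝ A where
  carrier := {x | IsSelfAdjoint x ∧ τ (CFC.abs x) < ∞}
  zero_mem' := ⟨IsSelfAdjoint.zero A, by rw [CFC.abs_zero, τ.map_zero]; exact ENNReal.zero_lt_top⟩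
  add_mem' := fun hx hy => ⟨hx.1.add hy.1,
    (τ.abs_add_le hx.1 hy.1).trans_lt (ENNReal.add_lt_top.2 ⟨hx.2, hy.2⟩)⟩
  smul_mem' := fun c x hx => ⟨(IsSelfAdjoint.all c).smul hx.1, by
    rw [τ.abs_smul]; exact ENNReal.mul_lt_top ENNReal.ofReal_lt_top hx.2⟩

/-- A copy of `𝔑_sa`, to be normed by `‖x‖₁ = τ(|x|)` instead of the norm of `A`. -/
def PreL1 : Type _ := τ.finiteSA

namespace PreL1

variable {τ}

instance : AddCommGroup τ.PreL1 := inferInstanceAs (AddCommGroup τ.finiteSA)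

instance : Module ℝ τ.PreL1 := inferInstanceAs (Module ℝ τ.finiteSA)

/-- The underlying element of `A`. -/
def val (x : τ.PreL1) : A := Subtype.val (p := (· ∈ τ.finiteSA)) x

/-- `‖x‖₁ = τ(|x|)`. -/
instance : Norm τ.PreL1 := ⟨fun x => (τ (CFC.abs x.val)).toReal⟩

theorem norm_def (x : τ.PreL1) : ‖x‖ = (τ (CFC.abs x.val)).toReal := rfl

theorem isSelfAdjoint (x : τ.PreL1) : IsSelfAdjoint x.val := x.2.1

theorem lt_top (x : τ.PreL1) : τ (CFC.abs x.val) < ∞ := x.2.2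

theorem val_add (x y : τ.PreL1) : (x + y).val = x.val + y.val := rfl

theorem val_smul (c : ℝ) (x : τ.PreL1) : (c • x).val = c • x.val := rfl

theorem normCore : NormedSpace.Core ℝ τ.PreL1 where
  norm_nonneg _ := ENNReal.toReal_nonneg
  norm_smul c x := by
    rw [norm_def, norm_def, val_smul, τ.abs_smul, ENNReal.toReal_mul,
      ENNReal.toReal_ofReal (norm_nonneg c)]
  norm_triangle x y := by
    rw [norm_def, norm_def, norm_def, val_add, ← ENNReal.toReal_add x.lt_top.ne y.lt_top.ne]
    exact ENNReal.toReal_mono (ENNReal.add_lt_top.2 ⟨x.lt_top, y.lt_top⟩).ne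
      (τ.abs_add_le x.isSelfAdjoint y.isSelfAdjoint)
  norm_eq_zero_iff x := by
    rw [norm_def, ENNReal.toReal_eq_zero_iff]
    constructor
    · rintro (h | h)
      · exact Subtype.ext (CFC.abs_eq_zero_iff.1 (τ.faithful _ (CFC.abs_nonneg _) h))
      · exact absurd h x.lt_top.ne
    · rintro rfl
      left
      change τ (CFC.abs (0 : A)) = 0
      rw [CFC.abs_zero, τ.map_zero]

instance : NormedAddCommGroup τ.PreL1 := NormedAddCommGroup.ofCore normCore

instance : NormedSpace ℝ τ.PreL1 := NormedSpace.ofCore normCore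

end PreL1

/-- The real Banach space `L₁(A_sa, τ)`: the completion of `{x = x⋆ : τ(|x|) < ∞}` with respect to
the norm `‖x‖₁ = τ(|x|)`. -/
abbrev L1 : Type _ := UniformSpace.Completion τ.PreL1

/-- The positive cone of `L₁(A_sa, τ)`: the norm closure of the set of positive elements of `A` of
finite trace. -/
def posCone : Set τ.L1 :=
  closure ((fun x : τ.PreL1 => (x : τ.L1)) '' {x | 0 ≤ x.val})

end FNSTrace

variable {τ : FNSTrace A}

/-- `T` is positive: `T x ≥ 0` whenever `x ≥ 0`. -/
def IsPositiveOp (T : τ.L1 →L[ℝ] τ.L1) : Prop := ∀ x ∈ τ.posCone, T x ∈ τ.posCone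

/-- A positive operator with `‖T x‖₁ ≤ ‖x‖₁` for all `x`. -/
structure IsPositiveContraction (T : τ.L1 →L[ℝ] τ.L1) : Prop where
  positive : IsPositiveOp T
  contraction : ∀ x, ‖T x‖ ≤ ‖x‖

/-- `T ≤ S`, i.e. `S - T` is positive. -/
def OpLE (T S : τ.L1 →L[ℝ] τ.L1) : Prop := IsPositiveOp (S - T)

end Generic

/-! ### A von Neumann algebra as an ordered C⋆-algebra -/

section VN

variable {H : Type*} [NormedAddCommGroup H] [InnerProductSpace ℂ H] [CompleteSpace H]

instance : SMulMemClass (VonNeumannAlgebra H) ℂ (H →L[ℂ] H) where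
  smul_mem {s} c _ hx := s.toStarSubalgebra.smul_mem hx c

instance (M : VonNeumannAlgebra H) : IsClosed (M : Set (H →L[ℂ] H)) := by
  rw [← M.centralizer_centralizer]
  exact Set.isClosed_centralizer _

/-- The order of `M` is the one induced by the order of bounded operators. -/
instance (M : VonNeumannAlgebra H) : StarOrderedRing M :=
  StarOrderedRing.of_nonneg_iff' (fun {x y} h z => add_le_add_right (α := H →L[ℂ] H) h z.1)
    (fun x => by
      constructor
      · intro hx
        have hx' : (0 : H →L[ℂ] H) ≤ x := hx
        have hmem : CFC.sqrt (x : H →L[ℂ] H) ∈ M := by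
          rw [CFC.sqrt_eq_real_sqrt _ hx', cfcₙ_eq_cfc]
          exact cfc_mem (𝕜' := ℂ) (s := M) Real.sqrt x.2
        refine ⟨⟨_, hmem⟩, Subtype.ext ?_⟩
        change (x : H →L[ℂ] H) = star (CFC.sqrt (x : H →L[ℂ] H)) * CFC.sqrt (x : H →L[ℂ] H)
        rw [(CFC.sqrt_nonneg (x : H →L[ℂ] H)).isSelfAdjoint.star_eq, CFC.sqrt_mul_sqrt_self _ hx']
      · rintro ⟨s, rfl⟩
        exact star_mul_self_nonneg (s : H →L[ℂ] H))

end VN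

end NCL1

end

namespace NCL1

variable {A : Type*} [CStarAlgebra A] [PartialOrder A] [StarOrderedRing A] {τ : FNSTrace A}

/-! ### Additivity of the norm on the positive cone -/

namespace FNSTrace

/-! The trace norm is additive on the positive cone, so for `x ≥ 0` every splitting `S = T + (S -
T)` turns into an equality of norms (`norm_eq_add`), and an operator norm can be tested on the cone
(`opNorm_le_of_posCone`). The theorem follows by induction on `n`. Put `c = ‖Z(Sⁿ - Tⁿ)‖ < 1` and,
for `x ≥ 0`, `a = ‖Z(Sⁿ⁺¹ - Tⁿ⁺¹)x‖`. If `a` were close to `‖x‖`, then `Tx` would have to be both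
large, since `a ≤ ‖Tx‖ + c‖x‖`, and small, since `(1 - c)‖Tx‖` is controlled by `‖x‖ - a`.
Eliminating `‖Tx‖` leaves `a ≤ d‖x‖` with `d < 1` depending only on `c`. -/

theorem PreL1.norm_of_nonneg {x : τ.PreL1} (hx : 0 ≤ x.val) : ‖x‖ = (τ x.val).toReal := by
  rw [PreL1.norm_def, CFC.abs_of_nonneg _ hx]

theorem PreL1.norm_add_of_nonneg {x y : τ.PreL1} (hx : 0 ≤ x.val) (hy : 0 ≤ y.val) :
    ‖x + y‖ = ‖x‖ + ‖y‖ := by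
  have hxy : 0 ≤ (x + y).val := by rw [PreL1.val_add]; exact add_nonneg hx hy
  have hx' := x.lt_top
  have hy' := y.lt_top
  rw [CFC.abs_of_nonneg _ hx] at hx'
  rw [CFC.abs_of_nonneg _ hy] at hy'
  rw [norm_of_nonneg hx, norm_of_nonneg hy, norm_of_nonneg hxy, PreL1.val_add,
    τ.map_add _ _ hx hy, ENNReal.toReal_add hx'.ne hy'.ne]

/-- The Jordan decomposition in `𝔑_sa`. -/
theorem PreL1.exists_nonneg_sub (x : τ.PreL1) :
    ∃ p q : τ.PreL1, 0 ≤ p.val ∧ 0 ≤ q.val ∧ x = p - q ∧ ‖x‖ = ‖p‖ + ‖q‖ := by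
  have hp := CFC.posPart_nonneg x.val
  have hq := CFC.negPart_nonneg x.val
  have hsum := τ.abs_eq x.isSelfAdjoint
  have hfin := x.lt_top
  rw [hsum, ENNReal.add_lt_top] at hfin
  let p : τ.PreL1 := ⟨(x.val)⁺, hp.isSelfAdjoint, by rw [CFC.abs_of_nonneg _ hp]; exact hfin.1⟩
  let q : τ.PreL1 := ⟨(x.val)⁻, hq.isSelfAdjoint, by rw [CFC.abs_of_nonneg _ hq]; exact hfin.2⟩
  refine ⟨p, q, hp, hq, Subtype.ext (CFC.posPart_sub_negPart x.val x.isSelfAdjoint).symm, ?_⟩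
  rw [norm_of_nonneg (x := p) hp, norm_of_nonneg (x := q) hq, PreL1.norm_def, hsum,
    ENNReal.toReal_add hfin.1.ne hfin.2.ne]
  rfl

theorem coe_mem_posCone {x : τ.PreL1} (hx : 0 ≤ x.val) : (x : τ.L1) ∈ τ.posCone :=
  subset_closure ⟨x, hx, rfl⟩

theorem zero_mem_posCone : (0 : τ.L1) ∈ τ.posCone :=
  coe_mem_posCone (x := (0 : τ.PreL1)) (le_refl (0 : A))

theorem add_mem_posCone {x y : τ.L1} (hx : x ∈ τ.posCone) (hy : y ∈ τ.posCone) :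
    x + y ∈ τ.posCone := by
  refine map_mem_closure₂ continuous_add hx hy ?_
  rintro _ ⟨a, ha, rfl⟩ _ ⟨b, hb, rfl⟩
  exact ⟨a + b, add_nonneg ha hb, UniformSpace.Completion.coe_add a b⟩

/-- The norm is additive on the positive cone. -/
theorem norm_add_of_mem_posCone {x y : τ.L1} (hx : x ∈ τ.posCone) (hy : y ∈ τ.posCone) :
    ‖x + y‖ = ‖x‖ + ‖y‖ := by
  -- The additivity defect is continuous and vanishes on a dense part of the cone, so its values lie
  -- in the closure of `{0}`.
  have hcl : IsClosed {r : ℝ | r = 0} := isClosed_singleton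
  have h : ‖x + y‖ - (‖x‖ + ‖y‖) ∈ closure {r : ℝ | r = 0} := by
    refine map_mem_closure₂ (f := fun x y : τ.L1 => ‖x + y‖ - (‖x‖ + ‖y‖))
      (by fun_prop) hx hy ?_
    rintro _ ⟨a, ha, rfl⟩ _ ⟨b, hb, rfl⟩
    have := PreL1.norm_add_of_nonneg ha hb
    simp only [Set.mem_ofPred_eq, ← UniformSpace.Completion.coe_add,
      UniformSpace.Completion.norm_coe, this, sub_self]
  rw [hcl.closure_eq] at h
  exact sub_eq_zero.1 h

end FNSTrace

open FNSTrace

/-- The norm of an operator is determined by its values on the positive cone. -/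
theorem opNorm_le_of_posCone {R : τ.L1 →L[ℝ] τ.L1} {d : ℝ} (hd : 0 ≤ d)
    (h : ∀ x ∈ τ.posCone, ‖R x‖ ≤ d * ‖x‖) : ‖R‖ ≤ d := by
  refine R.opNorm_le_bound hd fun x => ?_
  induction x using UniformSpace.Completion.induction_on with
  | hp => exact isClosed_le (by fun_prop) (by fun_prop)
  | ih x =>
    obtain ⟨p, q, hp, hq, rfl, hpq⟩ := x.exists_nonneg_sub
    rw [UniformSpace.Completion.norm_coe, hpq, UniformSpace.Completion.coe_sub, map_sub]
    have h1 := h _ (coe_mem_posCone hp)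
    have h2 := h _ (coe_mem_posCone hq)
    rw [UniformSpace.Completion.norm_coe] at h1 h2
    have h3 := norm_sub_le (R p) (R q)
    linarith

/-! ### Powers of positive contractions and the induction -/

namespace IsPositiveContraction

variable {Z T S : τ.L1 →L[ℝ] τ.L1}

theorem one : IsPositiveContraction (1 : τ.L1 →L[ℝ] τ.L1) :=
  ⟨fun _ hx => hx, fun _ => le_rfl⟩

theorem mul (hT : IsPositiveContraction T) (hS : IsPositiveContraction S) :
    IsPositiveContraction (T * S) :=
  ⟨fun _ hx => hT.positive _ (hS.positive _ hx),
    fun _ => (hT.contraction _).trans (hS.contraction _)⟩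

theorem pow (hT : IsPositiveContraction T) (n : ℕ) : IsPositiveContraction (T ^ n) := by
  induction n with
  | zero => rw [pow_zero]; exact one
  | succ n ih => rw [pow_succ]; exact ih.mul hT

theorem opLE_pow (hT : IsPositiveContraction T) (hS : IsPositiveContraction S) (hTS : OpLE T S)
    (n : ℕ) : OpLE (T ^ n) (S ^ n) := by
  induction n with
  | zero =>
    intro x _
    simpa using zero_mem_posCone
  | succ n ih =>
    -- Telescoping into products of positive operators.
    have h : S ^ (n + 1) - T ^ (n + 1) = S ^ n * (S - T) + (S ^ n - T ^ n) * T := by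
      rw [pow_succ, pow_succ, mul_sub, sub_mul]; abel
    intro x hx
    rw [h]
    exact add_mem_posCone ((hS.pow n).positive _ (hTS x hx)) (ih _ (hT.positive x hx))

/-- If `T ≤ S` and `P` is positive, then `‖P S x‖ = ‖P T x‖ + ‖P (S - T) x‖` for `x ≥ 0`. -/
theorem norm_eq_add {P T S : τ.L1 →L[ℝ] τ.L1} (hP : IsPositiveContraction P)
    (hT : IsPositiveContraction T) (hTS : OpLE T S) {x : τ.L1} (hx : x ∈ τ.posCone) :
    ‖P (S x)‖ = ‖P (T x)‖ + ‖P ((S - T) x)‖ := by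
  rw [← norm_add_of_mem_posCone (hP.positive _ (hT.positive _ hx)) (hP.positive _ (hTS _ hx)),
    ← _root_.map_add]
  simp

theorem norm_mul_pow_succ_sub_lt_one (hZ : IsPositiveContraction Z)
    (hT : IsPositiveContraction T) (hS : IsPositiveContraction S) (hTS : OpLE T S)
    (hZS : Z * S = S * Z) {n : ℕ} (hn : 1 ≤ n) (hlt : ‖Z * (S ^ n - T ^ n)‖ < 1) :
    ‖Z * (S ^ (n + 1) - T ^ (n + 1))‖ < 1 := by
  set c := ‖Z * (S ^ n - T ^ n)‖ with hc
  have hc0 : 0 ≤ c := norm_nonneg _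
  -- After clearing denominators this is `(1 - c)² > 0`.
  have hd : (2 + c * (1 - c)) / (3 - c) < 1 := by
    rw [div_lt_one (by linarith)]
    nlinarith
  refine lt_of_le_of_lt (opNorm_le_of_posCone
    (div_nonneg (by nlinarith) (by linarith)) fun x hx => ?_) hd
  have hTx := hT.positive x hx
  have hR : ∀ y, ‖Z ((S ^ n - T ^ n) y)‖ ≤ c * ‖y‖ := (Z * (S ^ n - T ^ n)).le_opNorm
  have h1 := hZ.norm_eq_add (hT.pow (n + 1)) (opLE_pow hT hS hTS (n + 1)) hx
  -- Commutation lets the extra `S` move to the outside, where it contracts.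
  have h2 : ‖Z ((S ^ (n + 1)) x)‖ ≤ ‖Z ((S ^ n) x)‖ := by
    have h : Z * S ^ (n + 1) = S * (Z * S ^ n) := by
      rw [pow_succ', ← mul_assoc, hZS, mul_assoc]
    calc ‖Z ((S ^ (n + 1)) x)‖ = ‖(Z * S ^ (n + 1)) x‖ := rfl
      _ = ‖S ((Z * S ^ n) x)‖ := by rw [h]; rfl
      _ ≤ _ := hS.contraction _
  have h3 := hZ.norm_eq_add (hT.pow n) (opLE_pow hT hS hTS n) hx
  have h4 : ‖Z ((S ^ (n + 1)) x)‖ = ‖Z ((S ^ n) (T x))‖ + ‖Z ((S ^ n) ((S - T) x))‖ := by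
    rw [pow_succ]
    exact (hZ.mul (hS.pow n)).norm_eq_add hT hTS hx
  have h5 : ‖S x‖ = ‖T x‖ + ‖(S - T) x‖ := one.norm_eq_add hT hTS hx
  have h6 : ‖Z ((S ^ n) ((S - T) x))‖ ≤ ‖(S - T) x‖ := (hZ.mul (hS.pow n)).contraction _
  have h7 : ‖Z ((S ^ n) (T x))‖ = ‖Z ((T ^ (n + 1)) x)‖ + ‖Z ((S ^ n - T ^ n) (T x))‖ := by
    rw [pow_succ]
    exact hZ.norm_eq_add (hT.pow n) (opLE_pow hT hS hTS n) hTx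
  -- Here `n ≥ 1` matters: one factor `T` must be available to act on `x` first.
  have h8 : ‖Z ((T ^ n) x)‖ ≤ ‖T x‖ := by
    obtain ⟨m, rfl⟩ := Nat.exists_eq_add_of_le' hn
    rw [pow_succ]
    exact (hZ.mul (hT.pow m)).contraction _
  have h9 : ‖Z ((S ^ (n + 1)) x)‖ ≤ ‖x‖ := (hZ.mul (hS.pow (n + 1))).contraction x
  have h10 := hS.contraction x
  have hx3 := hR x
  have hx7 := hR (T x)
  change ‖Z ((S ^ (n + 1) - T ^ (n + 1)) x)‖ ≤ _
  set a := ‖Z ((S ^ (n + 1) - T ^ (n + 1)) x)‖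
  have h0 := norm_nonneg (Z ((T ^ (n + 1)) x))
  -- From `h1`, `h2`, `h3`, `h8`: `a ≤ ‖ZSⁿx‖ ≤ ‖Tx‖ + c‖x‖`.
  have hTlow : a - c * ‖x‖ ≤ ‖T x‖ := by linarith
  -- Splitting the innermost `S` gives `‖ZSⁿ⁺¹x‖ ≤ ‖ZTⁿ⁺¹x‖ + c‖Tx‖ + ‖Sx‖ - ‖Tx‖`; now use `h1` and
  -- `‖Sx‖ ≤ ‖x‖`. The factor 2 is slack, as `a ≤ ‖x‖`.
  have hTup : (1 - c) * ‖T x‖ ≤ 2 * (‖x‖ - a) := by linarith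
  have hmul := mul_le_mul_of_nonneg_left hTlow (sub_nonneg.2 hlt.le)
  rw [div_mul_eq_mul_div, le_div_iff₀ (by linarith)]
  linarith

theorem norm_mul_pow_sub_lt_one (hZ : IsPositiveContraction Z)
    (hT : IsPositiveContraction T) (hS : IsPositiveContraction S) (hTS : OpLE T S)
    (hZS : Z * S = S * Z) {n₀ : ℕ} (hn₀ : 1 ≤ n₀) (hlt : ‖Z * (S ^ n₀ - T ^ n₀)‖ < 1)
    {n : ℕ} (hn : n₀ ≤ n) : ‖Z * (S ^ n - T ^ n)‖ < 1 := by
  induction n, hn using Nat.le_induction with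
  | base => exact hlt
  | succ n hn ih => exact norm_mul_pow_succ_sub_lt_one hZ hT hS hTS hZS (hn₀.trans hn) ih

end IsPositiveContraction

end NCL1

theorem theorem3p1 {H : Type*} [NormedAddCommGroup H] [InnerProductSpace ℂ H] [CompleteSpace H]
    (M : VonNeumannAlgebra H) (τ : NCL1.FNSTrace M) :
    (∀ Z T S : τ.L1 →L[ℝ] τ.L1,
      NCL1.IsPositiveContraction Z → NCL1.IsPositiveContraction T → NCL1.IsPositiveContraction S →
      NCL1.OpLE T S → Z * S = S * Z →
      ∀ n₀ : ℕ, 1 ≤ n₀ → ‖Z * (S ^ n₀ - T ^ n₀)‖ < 1 →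
        ∀ n : ℕ, n₀ ≤ n → ‖Z * (S ^ n - T ^ n)‖ < 1) ∧
    (∀ T S : τ.L1 →L[ℝ] τ.L1,
      NCL1.IsPositiveContraction T → NCL1.IsPositiveContraction S → NCL1.OpLE T S →
      ∀ n₀ : ℕ, 1 ≤ n₀ → ‖S ^ n₀ - T ^ n₀‖ < 1 →
        ∀ n : ℕ, n₀ ≤ n → ‖S ^ n - T ^ n‖ < 1) := by
  refine ⟨fun Z T S hZ hT hS hTS hZS n₀ hn₀ hlt n hn =>
    hZ.norm_mul_pow_sub_lt_one hT hS hTS hZS hn₀ hlt hn, fun T S hT hS hTS n₀ hn₀ hlt n hn => ?_⟩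
  rw [← one_mul (S ^ n₀ - T ^ n₀)] at hlt
  rw [← one_mul (S ^ n - T ^ n)]
  exact NCL1.IsPositiveContraction.one.norm_mul_pow_sub_lt_one hT hS hTS
    ((one_mul S).trans (mul_one S).symm) hn₀ hlt hn
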